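/- Let $\mathbb K\in\{\mathbb R,\mathbb C\}$, let $\Omega\subset\mathbb R^d$ be open and non-empty, let $p\in[1,\infty)$, and let $L_p(\Omega)$ be the space of $\mathbb K$-valued $L_p$-functions on $\Omega$ with respect to Lebesgue measure. Write $u\ge 0$ if $u(y)\in[0,\infty)$ for almost every $y\in\Omega$, and $v\le u$ if $u-v\ge0$. Let $S=(S_t)_{t>0}$ be a $C_0$-semigroup of bounded linear operators on $L_p(\Omega)$, that is, $S_{t+s}=S_tS_s$ for all $s,t>0$ and $\lim_{t\downarrow0}S_tu=u$ for all $u\in L_p(\Omega)$. Suppose that $S$ is - positive: $S_tu\ge0$ for all $t>0$ and $u\ge0$; - irreducible: if $J\subset L_p(\Omega)$ is a closed ideal with $S_tJ\subset J$ for all $t>0$, then $J=\{0\}$ or $J=L_p(\Omega)$, where an ideal is a linear subspace $J$ such that $u\in J$ implies $|u|\in J$, and $u\in J$, $0\le v\le u$ imply $v\in J$; - holomorphic: for some $\theta\in(0,\pi/2]$ the map $t\mapsto S_t$ (its complexification on $L_p(\Omega;\mathbb C)$ if $\mathbb K=\mathbb R$) extends to a holomorphic operator-valued map on the sector $\Sigma_\theta=\{z\in\mathbb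 C\setminus\{0\}:|\arg z|<\theta\}$ which is bounded on $\{z\in\Sigma_{\theta'}:|z|\le1\}$ for every $\theta'\in(0,\theta)$. Let $X$ be a set with $\Omega\subset X\subset\overline\Omega$ and let $x\in X$. For $u\in L_p(\Omega)$ we write $u\in C(X)$ if there is a (necessarily unique) continuous function $\tilde u\colon X\to\mathbb K$ with $\tilde u=u$ almost everywhere on $\Omega$, and we then write $u(x)$ for $\tilde u(x)$. Suppose that 1. $S_tL_p(\Omega)\subset C(X)$ for all $t>0$, and 2. there are $t>0$ and $w\in L_p(\Omega)$ such that $(S_tw)(x)\ne0$. Then $(S_tu)(x)>0$ for all $t>0$ and all $u\in L_p(\Omega)$ with $u\ge0$ and $u\ne0$. -/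

import Mathlib

open MeasureTheory Filter Topology Set
open scoped ENNReal ComplexOrder

namespace PosSemigroup

/-! Throughout, `𝕜` is `ℝ` or `ℂ` with the order of Mathlib's `ComplexOrder`, in which
`0 ≤ z` means that `z` is a real number in `[0, ∞)`. Accordingly `0 ≤ u` for `u` in `L_p` means
that `u y ∈ [0, ∞)` for almost every `y`. -/

section Lattice

variable {α : Type*} [MeasurableSpace α] {μ : Measure α} {p : ℝ≥0∞} {𝕜 : Type*} [RCLike 𝕜]

/-- The modulus `|u|` of `u ∈ L_p(μ; 𝕜)`, that is, the class of `y ↦ |u(y)|`, seen in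
`L_p(μ; 𝕜)`. -/
noncomputable def lpAbs (u : Lp 𝕜 p μ) : Lp 𝕜 p μ :=
  MemLp.toLp (fun y => ((‖u y‖ : ℝ) : 𝕜)) (Lp.memLp u).norm.ofReal

/-- A subspace `J` of `L_p` is an (order) ideal if `u ∈ J` implies `|u| ∈ J`, and
`u ∈ J`, `0 ≤ v ≤ u` imply `v ∈ J`. -/
structure IsOrderIdeal (J : Submodule 𝕜 (Lp 𝕜 p μ)) : Prop where
  abs_mem : ∀ u ∈ J, lpAbs u ∈ J
  mem_of_le : ∀ u ∈ J, ∀ v : Lp 𝕜 p μ, 0 ≤ v → v ≤ u → v ∈ J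

/-- The canonical embedding `L_p(μ; 𝕜) → L_p(μ; ℂ)`. For `𝕜 = ℝ` it regards a real function as a
complex one, for `𝕜 = ℂ` it is the identity. -/
noncomputable def toComplexLp (u : Lp 𝕜 p μ) : Lp ℂ p μ :=
  (RCLike.map 𝕜 ℂ).compLp u

end Lattice

section Semigroup

/-- A `C₀`-semigroup `(S_t)_{t > 0}` on a normed space. Only the values of `S` at `t > 0` are
used. -/
structure IsC0Semigroup {𝕜 E : Type*} [RCLike 𝕜] [NormedAddCommGroup E] [NormedSpace 𝕜 E]
    (S : ℝ → E →L[𝕜] E) : Prop where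
  add : ∀ t s : ℝ, 0 < t → 0 < s → S (t + s) = (S t).comp (S s)
  tendsto : ∀ u : E, Tendsto (fun t => S t u) (𝓝[>] 0) (𝓝 u)

variable {α : Type*} [MeasurableSpace α] {μ : Measure α} {p : ℝ≥0∞} [Fact (1 ≤ p)]
  {𝕜 : Type*} [RCLike 𝕜]

/-- `S_t ≥ 0` for all `t > 0`. -/
def IsPositive (S : ℝ → Lp 𝕜 p μ →L[𝕜] Lp 𝕜 p μ) : Prop :=
  ∀ t : ℝ, 0 < t → ∀ u : Lp 𝕜 p μ, 0 ≤ u → 0 ≤ S t u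

/-- The semigroup leaves no closed ideal invariant besides `{0}` and the whole space. -/
def IsIrreducible (S : ℝ → Lp 𝕜 p μ →L[𝕜] Lp 𝕜 p μ) : Prop :=
  ∀ J : Submodule 𝕜 (Lp 𝕜 p μ), IsOrderIdeal J → IsClosed (J : Set (Lp 𝕜 p μ)) →
    (∀ t : ℝ, 0 < t → ∀ u ∈ J, S t u ∈ J) → J = ⊥ ∨ J = ⊤

/-- The open sector `{z ≠ 0 : |arg z| < θ}`. -/
def sector (θ : ℝ) : Set ℂ := {z | z ≠ 0 ∧ |z.arg| < θ}

/-- Holomorphy of a semigroup on `L_p(μ; 𝕜)`: for some `θ ∈ (0, π/2]` the semigroup extends to a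
holomorphic operator-valued map on the sector of half-angle `θ` that is bounded near `0` on every
strictly smaller sector. The extension acts on `L_p(μ; ℂ)`. If `𝕜 = ℂ`, this is the usual notion.
If `𝕜 = ℝ`, the last condition says that the extension at `t > 0` is the complexification of `S_t`,
so this is the usual notion for the complexified semigroup. -/
def IsHolomorphic (S : ℝ → Lp 𝕜 p μ →L[𝕜] Lp 𝕜 p μ) : Prop :=
  ∃ θ : ℝ, 0 < θ ∧ θ ≤ Real.pi / 2 ∧ ∃ F : ℂ → Lp ℂ p μ →L[ℂ] Lp ℂ p μ,
    DifferentiableOn ℂ F (sector θ) ∧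
    (∀ θ' : ℝ, 0 < θ' → θ' < θ → ∃ M : ℝ, ∀ z ∈ sector θ', ‖z‖ ≤ 1 → ‖F z‖ ≤ M) ∧
    ∀ t : ℝ, 0 < t → ∀ u : Lp 𝕜 p μ, F (t : ℂ) (toComplexLp u) = toComplexLp (S t u)

end Semigroup

/-- `g` is a representative of `u ∈ L_p(Ω)` that is continuous on `X`: this is the function
`ũ ∈ C(X)` with `ũ = u` almost everywhere on `Ω` (the values of `g` outside `X` play no role).
For `Ω` open and `Ω ⊆ X ⊆ closure Ω` the values of `g` on `X` are determined by `u`. -/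
def IsContinuousRep {d : ℕ} {p : ℝ≥0∞} {𝕜 : Type*} [RCLike 𝕜]
    {Ω : Set (EuclideanSpace ℝ (Fin d))} (X : Set (EuclideanSpace ℝ (Fin d)))
    (u : Lp 𝕜 p (volume.restrict Ω)) (g : EuclideanSpace ℝ (Fin d) → 𝕜) : Prop :=
  ContinuousOn g X ∧ ∀ᵐ y ∂(volume.restrict Ω), g y = u y

end PosSemigroup

/-! Evaluation at `x` turns the semigroup into positive bounded functionals `φ t u = (S_t u)(x)`
with `φ (t + s) = φ t ∘ S s`. Suppose `φ t u = 0` for one `t` and some nonzero `u ≥ 0`. By strong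
continuity, `u` is a limit of `v n ≥ 0` with `v n ≤ S (τ k) u` for `k ≥ n`, where `τ k ↓ 0` along a
fast sequence. Positivity gives `0 ≤ φ (t - τ k) (v n) ≤ φ t u = 0`, so the real-analytic function
`s ↦ φ s (v n)` has zeros accumulating at `t` and vanishes identically; letting `n → ∞`, `φ s u = 0`
for every `s > 0` (`functional_eq_zero_of_eq_zero`).

Hence `u` lies in the closed invariant ideal of all `v` with `φ r |v| = 0` for every `r > 0`. By
irreducibility this ideal is everything, so all `φ s` vanish (`functional_eq_zero_of_exists`),
against the assumption that some `(S_t w)(x)` is nonzero. -/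

namespace PosSemigroup

/-! ### Order and modulus in `L_p` over `ℝ` or `ℂ` -/

section Lattice

variable {α : Type*} [MeasurableSpace α] {μ : Measure α} {p : ℝ≥0∞} {𝕜 : Type*} [RCLike 𝕜]

lemma coeFn_lpAbs (u : Lp 𝕜 p μ) : ∀ᵐ y ∂μ, lpAbs u y = ((‖u y‖ : ℝ) : 𝕜) :=
  MemLp.coeFn_toLp _

lemma le_iff_ae {u v : Lp 𝕜 p μ} : u ≤ v ↔ ∀ᵐ y ∂μ, u y ≤ v y :=
  (Lp.coeFn_le u v).symm

lemma nonneg_iff_ae {u : Lp 𝕜 p μ} : 0 ≤ u ↔ ∀ᵐ y ∂μ, 0 ≤ u y :=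
  (Lp.coeFn_nonneg u).symm

lemma lpAbs_nonneg (u : Lp 𝕜 p μ) : 0 ≤ lpAbs u := by
  rw [nonneg_iff_ae]
  filter_upwards [coeFn_lpAbs u] with y hy
  rw [hy]
  exact RCLike.ofReal_nonneg.2 (norm_nonneg _)

lemma lpAbs_of_nonneg {u : Lp 𝕜 p μ} (hu : 0 ≤ u) : lpAbs u = u := by
  rw [nonneg_iff_ae] at hu
  apply Lp.ext
  filter_upwards [coeFn_lpAbs u, hu] with y hy h
  rw [hy, RCLike.norm_of_nonneg' h]

lemma norm_lpAbs (u : Lp 𝕜 p μ) : ‖lpAbs u‖ = ‖u‖ := by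
  apply le_antisymm <;> apply Lp.norm_le_norm_of_ae_le <;>
    filter_upwards [coeFn_lpAbs u] with y hy <;> simp [hy]

lemma lpAbs_add_le (u v : Lp 𝕜 p μ) : lpAbs (u + v) ≤ lpAbs u + lpAbs v := by
  rw [le_iff_ae]
  filter_upwards [coeFn_lpAbs u, coeFn_lpAbs v, coeFn_lpAbs (u + v), Lp.coeFn_add u v,
    Lp.coeFn_add (lpAbs u) (lpAbs v)] with y h1 h2 h3 h4 h5
  rw [h3, h5, h4, Pi.add_apply, Pi.add_apply, h1, h2, ← RCLike.ofReal_add, RCLike.ofReal_le_ofReal]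
  exact norm_add_le _ _

lemma lpAbs_smul (c : 𝕜) (u : Lp 𝕜 p μ) : lpAbs (c • u) = ((‖c‖ : ℝ) : 𝕜) • lpAbs u := by
  apply Lp.ext
  filter_upwards [coeFn_lpAbs u, coeFn_lpAbs (c • u), Lp.coeFn_smul c u,
    Lp.coeFn_smul ((‖c‖ : ℝ) : 𝕜) (lpAbs u)] with y h1 h2 h3 h4
  rw [h2, h4, h3, Pi.smul_apply, Pi.smul_apply, h1]
  simp

/-- The two bounds force `w`, and then `u`, to be real-valued, so the claim reduces to `abs_le`
pointwise. -/
lemma lpAbs_le_of_neg_le_of_le {u w : Lp 𝕜 p μ} (h₁ : -w ≤ u) (h₂ : u ≤ w) : lpAbs u ≤ w := by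
  rw [le_iff_ae] at *
  filter_upwards [coeFn_lpAbs u, Lp.coeFn_neg w, h₁, h₂] with y h h' h1 h2
  rw [h', Pi.neg_apply] at h1
  have h0 : (0 : 𝕜) ≤ w y + w y := by simpa using add_le_add (neg_le.1 h1) h2
  rw [RCLike.le_iff_re_im] at h0 h1 h2
  simp only [map_add, map_neg, map_zero] at h0 h1 h2
  have hu : u y = ((RCLike.re (u y) : ℝ) : 𝕜) := by
    apply RCLike.ext <;> simp; linarith
  rw [h, RCLike.le_iff_re_im, hu]
  simp only [RCLike.norm_ofReal, RCLike.ofReal_re, RCLike.ofReal_im]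
  exact ⟨abs_le.2 ⟨h1.1, h2.1⟩, by linarith⟩

lemma le_lpAbs_of_le {u w : Lp 𝕜 p μ} (hw : 0 ≤ w) (h : u ≤ w) : u ≤ lpAbs u := by
  rw [nonneg_iff_ae] at hw
  rw [le_iff_ae] at *
  filter_upwards [coeFn_lpAbs u, hw, h] with y h h1 h2
  rw [RCLike.le_iff_re_im] at *
  simp only [map_zero] at h1
  rw [h]
  simp only [RCLike.ofReal_re, RCLike.ofReal_im]
  exact ⟨RCLike.re_le_norm _, by linarith⟩

lemma exists_eq_add_smul_I (u : Lp 𝕜 p μ) : ∃ a b : Lp 𝕜 p μ, u = a + (RCLike.I : 𝕜) • b ∧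
    -lpAbs u ≤ a ∧ a ≤ lpAbs u ∧ -lpAbs u ≤ b ∧ b ≤ lpAbs u := by
  let R : 𝕜 →L[ℝ] 𝕜 := RCLike.ofRealCLM ∘L RCLike.reCLM
  let T : 𝕜 →L[ℝ] 𝕜 := RCLike.ofRealCLM ∘L RCLike.imCLM
  refine ⟨R.compLp u, T.compLp u, ?_, ?_, ?_, ?_, ?_⟩
  · apply Lp.ext
    filter_upwards [R.coeFn_compLp u, T.coeFn_compLp u, Lp.coeFn_smul (RCLike.I : 𝕜) (T.compLp u),
      Lp.coeFn_add (R.compLp u) ((RCLike.I : 𝕜) • T.compLp u)] with y h1 h2 h3 h4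
    rw [h4, Pi.add_apply, h3, Pi.smul_apply, h1, h2]
    simp only [R, T, ContinuousLinearMap.comp_apply, RCLike.reCLM_apply, RCLike.imCLM_apply,
      RCLike.ofRealCLM_apply, smul_eq_mul]
    rw [mul_comm, RCLike.re_add_im]
  all_goals
    rw [le_iff_ae]
    filter_upwards [R.coeFn_compLp u, T.coeFn_compLp u, coeFn_lpAbs u,
      Lp.coeFn_neg (lpAbs u)] with y h1 h2 h3 h4
    simp only [h1, h2, h3, h4, R, T, ContinuousLinearMap.comp_apply, RCLike.reCLM_apply,
      RCLike.imCLM_apply, RCLike.ofRealCLM_apply, Pi.neg_apply, ← RCLike.ofReal_neg,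
      RCLike.ofReal_le_ofReal]
  · exact (abs_le.1 (RCLike.abs_re_le_norm _)).1
  · exact (abs_le.1 (RCLike.abs_re_le_norm _)).2
  · exact (abs_le.1 (RCLike.abs_im_le_norm _)).1
  · exact (abs_le.1 (RCLike.abs_im_le_norm _)).2

/-- Being below `w ≥ 0` makes `u` real-valued, so the middle term is its positive part. -/
lemma half_smul_add_lpAbs_mem_Icc {u w : Lp 𝕜 p μ} (hw : 0 ≤ w) (h : u ≤ w) :
    0 ≤ (2⁻¹ : 𝕜) • (u + lpAbs u) ∧ (2⁻¹ : 𝕜) • (u + lpAbs u) ≤ w := by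
  rw [nonneg_iff_ae] at *
  rw [le_iff_ae] at *
  rw [← eventually_and]
  filter_upwards [coeFn_lpAbs u, Lp.coeFn_smul (2⁻¹ : 𝕜) (u + lpAbs u), Lp.coeFn_add u (lpAbs u),
    hw, h] with y h1 h2 h3 h4 h5
  have e : (2⁻¹ : 𝕜) = ((2⁻¹ : ℝ) : 𝕜) := by
    rw [RCLike.ofReal_inv, RCLike.ofReal_ofNat]
  rw [h2, Pi.smul_apply, h3, Pi.add_apply, h1, smul_eq_mul, e]
  rw [RCLike.le_iff_re_im] at h4 h5
  simp only [map_zero] at h4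
  have hu : u y = ((RCLike.re (u y) : ℝ) : 𝕜) := by
    apply RCLike.ext <;> simp; linarith
  rw [hu, RCLike.norm_ofReal, ← RCLike.ofReal_add, ← RCLike.ofReal_mul, RCLike.ofReal_nonneg,
    RCLike.le_iff_re_im (K := 𝕜), RCLike.ofReal_re, RCLike.ofReal_im]
  rcases abs_cases (RCLike.re (u y)) with h | h <;>
    refine ⟨?_, ?_, ?_⟩ <;> linarith

lemma map_le_map {E : Type*} [AddCommGroup E] [Module 𝕜 E] [PartialOrder E] [IsOrderedAddMonoid E]
    {T : Lp 𝕜 p μ →ₗ[𝕜] E} (hT : ∀ u, 0 ≤ u → 0 ≤ T u) {u v : Lp 𝕜 p μ} (h : u ≤ v) :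
    T u ≤ T v := by
  have := hT (v - u) (sub_nonneg.2 h)
  rwa [map_sub, sub_nonneg] at this

variable [Fact (1 ≤ p)]

lemma continuous_lpAbs : Continuous (lpAbs : Lp 𝕜 p μ → Lp 𝕜 p μ) := by
  refine (LipschitzWith.of_dist_le_mul (K := 1) fun u v => ?_).continuous
  rw [NNReal.coe_one, one_mul, dist_eq_norm, dist_eq_norm]
  apply Lp.norm_le_norm_of_ae_le
  filter_upwards [coeFn_lpAbs u, coeFn_lpAbs v, Lp.coeFn_sub u v,
    Lp.coeFn_sub (lpAbs u) (lpAbs v)] with y h1 h2 h3 h4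
  rw [h4, h3, Pi.sub_apply, Pi.sub_apply, h1, h2, ← RCLike.ofReal_sub, RCLike.norm_ofReal]
  exact abs_norm_sub_norm_le _ _

end Lattice

/-! ### Positive operators and functionals -/

section Positive

variable {α : Type*} [MeasurableSpace α] {μ : Measure α} {p : ℝ≥0∞} [Fact (1 ≤ p)]
  {𝕜 : Type*} [RCLike 𝕜]

/-- Splitting into real and imaginary parts costs a factor 2. This is harmless, since the bound only
serves to show that a functional vanishes on `|T u|`. -/
lemma lpAbs_map_le {T : Lp 𝕜 p μ →L[𝕜] Lp 𝕜 p μ} (hT : ∀ u, 0 ≤ u → 0 ≤ T u) (u : Lp 𝕜 p μ) :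
    lpAbs (T u) ≤ T (lpAbs u) + T (lpAbs u) := by
  obtain ⟨a, b, hu, ha, ha', hb, hb'⟩ := exists_eq_add_smul_I u
  have key : ∀ c, -lpAbs u ≤ c → c ≤ lpAbs u → lpAbs (T c) ≤ T (lpAbs u) := fun c h h' =>
    lpAbs_le_of_neg_le_of_le (by simpa using map_le_map (T := T.toLinearMap) hT h)
      (map_le_map (T := T.toLinearMap) hT h')
  have hI : lpAbs ((RCLike.I : 𝕜) • T b) ≤ lpAbs (T b) := by
    rw [lpAbs_smul]
    rcases RCLike.I_mul_I_ax (K := 𝕜) with h | h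
    · simpa [h] using lpAbs_nonneg (T b)
    · have : ‖(RCLike.I : 𝕜)‖ = 1 := RCLike.norm_I_of_ne_zero (by rintro h0; simp [h0] at h)
      simp [this]
  calc lpAbs (T u) = lpAbs (T a + (RCLike.I : 𝕜) • T b) := by
        conv_lhs => rw [hu]
        rw [map_add, map_smul]
    _ ≤ lpAbs (T a) + lpAbs ((RCLike.I : 𝕜) • T b) := lpAbs_add_le _ _
    _ ≤ T (lpAbs u) + T (lpAbs u) := add_le_add (key a ha ha') (hI.trans (key b hb hb'))

lemma map_eq_zero_of_map_lpAbs_eq_zero {φ : Lp 𝕜 p μ →L[𝕜] 𝕜} (hφ : ∀ u, 0 ≤ u → 0 ≤ φ u)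
    {u : Lp 𝕜 p μ} (h : φ (lpAbs u) = 0) : φ u = 0 := by
  obtain ⟨a, b, hu, ha, ha', hb, hb'⟩ := exists_eq_add_smul_I u
  have key : ∀ c, -lpAbs u ≤ c → c ≤ lpAbs u → φ c = 0 := fun c h1 h2 =>
    le_antisymm ((map_le_map (T := φ.toLinearMap) hφ h2).trans_eq h)
      (by simpa [h] using map_le_map (T := φ.toLinearMap) hφ h1)
  rw [hu, map_add, map_smul, key a ha ha', key b hb hb']
  simp

end Positive

/-! ### Point evaluation as a bounded functional -/

section Evaluation

lemma exists_clm_setAverage {α : Type*} [MeasurableSpace α] {μ : Measure α} {p : ℝ≥0∞}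
    [Fact (1 ≤ p)] {𝕜 : Type*} [RCLike 𝕜] {A : Set α} (hA : μ A ≠ ∞) :
    ∃ L : Lp 𝕜 p μ →L[𝕜] 𝕜, ∀ u : Lp 𝕜 p μ, L u = ⨍ y in A, u y ∂μ := by
  have hfin : IsFiniteMeasure (μ.restrict A) := isFiniteMeasure_restrict.2 hA
  have h1p : (1 : ℝ≥0∞) ≤ p := Fact.out
  have hint : ∀ u : Lp 𝕜 p μ, Integrable u (μ.restrict A) := fun u =>
    ((Lp.memLp u).restrict A).integrable h1p
  let c : ℝ≥0∞ := μ.restrict A univ ^ (1 / (1 : ℝ≥0∞).toReal - 1 / p.toReal)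
  have hc : c ≠ ∞ := by
    refine ENNReal.rpow_ne_top_of_nonneg ?_ (measure_ne_top _ _)
    rcases eq_or_ne p ∞ with rfl | hp
    · simp
    · have : 1 ≤ p.toReal := by simpa using ENNReal.toReal_mono hp h1p
      simpa using inv_le_one_of_one_le₀ this
  let I : Lp 𝕜 p μ →L[𝕜] 𝕜 := LinearMap.mkContinuous
    { toFun := fun u => ∫ y in A, u y ∂μ
      map_add' := fun u v => by
        rw [← integral_add (hint u) (hint v)]
        exact integral_congr_ae (ae_restrict_of_ae (Lp.coeFn_add u v))
      map_smul' := fun a u => by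
        rw [RingHom.id_apply, ← integral_smul]
        exact integral_congr_ae (ae_restrict_of_ae (Lp.coeFn_smul a u)) }
    c.toReal (fun u => by
      have h1 : ‖∫ y in A, u y ∂μ‖ ≤ (eLpNorm u 1 (μ.restrict A)).toReal := by
        rw [eLpNorm_one_eq_lintegral_enorm, ← integral_norm_eq_lintegral_enorm (hint u).1]
        exact norm_integral_le_integral_norm _
      refine h1.trans ?_
      rw [Lp.norm_def, mul_comm, ← ENNReal.toReal_mul]
      refine ENNReal.toReal_mono (ENNReal.mul_ne_top (Lp.eLpNorm_ne_top u) hc) ?_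
      refine (eLpNorm_le_eLpNorm_mul_rpow_measure_univ h1p (hint u).1).trans ?_
      gcongr
      exact Measure.restrict_le_self)
  refine ⟨((((μ.real A)⁻¹ : ℝ) : 𝕜)) • I, fun u => ?_⟩
  rw [setAverage_eq, RCLike.real_smul_eq_coe_mul]
  rfl

variable {d : ℕ} {p : ℝ≥0∞} {𝕜 : Type*} [RCLike 𝕜] {Ω X : Set (EuclideanSpace ℝ (Fin d))}
  {x : EuclideanSpace ℝ (Fin d)}

lemma restrict_ball_ne_zero (hΩ : IsOpen Ω) (hx : x ∈ closure Ω) {r : ℝ} (hr : 0 < r) :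
    volume.restrict Ω (Metric.ball x r) ≠ 0 := by
  rw [Measure.restrict_apply Metric.isOpen_ball.measurableSet]
  refine (Metric.isOpen_ball.inter hΩ).measure_ne_zero _ ?_
  exact mem_closure_iff.1 hx _ Metric.isOpen_ball (Metric.mem_ball_self hr)

lemma restrict_ball_ne_top (r : ℝ) : volume.restrict Ω (Metric.ball x r) ≠ ∞ :=
  ((Measure.restrict_le_self _).trans_lt measure_ball_lt_top).ne

variable [Fact (1 ≤ p)]

lemma integrable_restrict_ball (u : Lp 𝕜 p (volume.restrict Ω)) (r : ℝ) :
    IntegrableOn u (Metric.ball x r) (volume.restrict Ω) := by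
  have : IsFiniteMeasure ((volume.restrict Ω).restrict (Metric.ball x r)) :=
    isFiniteMeasure_restrict.2 (restrict_ball_ne_top r)
  exact ((Lp.memLp u).restrict _).integrable Fact.out

lemma IsContinuousRep.tendsto_setAverage (hΩ : IsOpen Ω) (hΩX : Ω ⊆ X) (hXΩ : X ⊆ closure Ω)
    (hx : x ∈ X) {u : Lp 𝕜 p (volume.restrict Ω)} {g : EuclideanSpace ℝ (Fin d) → 𝕜}
    (hg : IsContinuousRep X u g) :
    Tendsto (fun n : ℕ => ⨍ y in Metric.ball x (1 / ((n : ℝ) + 1)), u y ∂(volume.restrict Ω))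
      atTop (𝓝 (g x)) := by
  rw [(Metric.nhds_basis_closedBall (x := g x)).tendsto_right_iff]
  intro ε hε
  obtain ⟨δ, hδ, h⟩ := Metric.continuousWithinAt_iff.1 (hg.1 x hx) ε hε
  filter_upwards [tendsto_one_div_add_atTop_nhds_zero_nat.eventually (gt_mem_nhds hδ)] with n hn
  refine (convex_closedBall (g x) ε).set_average_mem Metric.isClosed_closedBall
    (restrict_ball_ne_zero hΩ (hXΩ hx) Nat.one_div_pos_of_nat) (restrict_ball_ne_top _) ?_
    (integrable_restrict_ball u _)
  filter_upwards [ae_restrict_of_ae hg.2, ae_restrict_of_ae (ae_restrict_mem hΩ.measurableSet),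
    ae_restrict_mem Metric.isOpen_ball.measurableSet] with y h1 h2 h3
  rw [← h1]
  exact (h (hΩX h2) ((Metric.mem_ball.1 h3).trans hn)).le

lemma IsContinuousRep.nonneg (hΩ : IsOpen Ω) (hΩX : Ω ⊆ X) (hXΩ : X ⊆ closure Ω)
    (hx : x ∈ X) {u : Lp 𝕜 p (volume.restrict Ω)} {g : EuclideanSpace ℝ (Fin d) → 𝕜}
    (hg : IsContinuousRep X u g) (hu : 0 ≤ u) : 0 ≤ g x := by
  refine isClosed_Ici.mem_of_tendsto (hg.tendsto_setAverage hΩ hΩX hXΩ hx)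
    (Eventually.of_forall fun n => ?_)
  exact (convex_Ici (0 : 𝕜)).set_average_mem isClosed_Ici
    (restrict_ball_ne_zero hΩ (hXΩ hx) Nat.one_div_pos_of_nat) (restrict_ball_ne_top _)
    (ae_restrict_of_ae (nonneg_iff_ae.1 hu)) (integrable_restrict_ball u _)

/-- Evaluation at `x` is the pointwise limit of averages over shrinking balls. Each average is
bounded on `L_p`, so the limit is bounded by Banach–Steinhaus. -/
lemma exists_clm_eval (hΩ : IsOpen Ω) (hΩX : Ω ⊆ X) (hXΩ : X ⊆ closure Ω) (hx : x ∈ X)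
    {E : Type*} [NormedAddCommGroup E] [NormedSpace 𝕜 E] [CompleteSpace E]
    (T : E →L[𝕜] Lp 𝕜 p (volume.restrict Ω)) (hT : ∀ u, ∃ g, IsContinuousRep X (T u) g) :
    ∃ φ : E →L[𝕜] 𝕜, ∀ u g, IsContinuousRep X (T u) g → φ u = g x := by
  choose G hG using hT
  choose L hL using fun n : ℕ => exists_clm_setAverage (p := p) (𝕜 := 𝕜)
    (restrict_ball_ne_top (Ω := Ω) (x := x) (1 / ((n : ℝ) + 1)))
  have hlim : ∀ u g, IsContinuousRep X (T u) g →
      Tendsto (fun n => (L n).comp T u) atTop (𝓝 (g x)) := fun u g h => by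
    simpa only [ContinuousLinearMap.comp_apply, hL] using h.tendsto_setAverage hΩ hΩX hXΩ hx
  refine ⟨continuousLinearMapOfTendsto (f := fun u => G u x) (fun n => (L n).comp T)
    (tendsto_pi_nhds.2 fun u => hlim u _ (hG u)), fun u g h => ?_⟩
  exact tendsto_nhds_unique (hlim u _ (hG u)) (hlim u g h)

end Evaluation

/-! ### Real analyticity of the orbits -/

section Analytic

variable {α : Type*} [MeasurableSpace α] {μ : Measure α} {p : ℝ≥0∞} {𝕜 : Type*} [RCLike 𝕜]

lemma map_complex_toComplexLp (u : Lp 𝕜 p μ) : (RCLike.map ℂ 𝕜).compLp (toComplexLp u) = u := by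
  apply Lp.ext
  filter_upwards [(RCLike.map ℂ 𝕜).coeFn_compLp (toComplexLp u),
    (RCLike.map 𝕜 ℂ).coeFn_compLp u] with y h1 h2
  rw [h1, toComplexLp, h2]
  simp

lemma sector_mem_nhds {θ : ℝ} (hθ : 0 < θ) {t : ℝ} (ht : 0 < t) : sector θ ∈ 𝓝 (t : ℂ) := by
  have hc : Tendsto (fun z : ℂ => |z.arg|) (𝓝 (t : ℂ)) (𝓝 0) := by
    have h := (Complex.continuousAt_arg (x := (t : ℂ)) (by simp [ht])).abs
    simpa [ContinuousAt, Complex.arg_ofReal_of_nonneg ht.le] using h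
  filter_upwards [hc.eventually (gt_mem_nhds hθ),
    isOpen_ne.mem_nhds (Complex.ofReal_ne_zero.2 ht.ne')] with z h1 h2
  exact ⟨h2, h1⟩

variable [Fact (1 ≤ p)]

lemma IsHolomorphic.analyticOnNhd {S : ℝ → Lp 𝕜 p μ →L[𝕜] Lp 𝕜 p μ} (hS : IsHolomorphic S)
    (u : Lp 𝕜 p μ) : AnalyticOnNhd ℝ (fun t => S t u) (Ioi 0) := by
  obtain ⟨θ, hθ, -, F, hF, -, hFS⟩ := hS
  intro t ht
  have h1 : AnalyticAt ℝ (fun z : ℂ => F z (toComplexLp u)) (t : ℂ) :=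
    ((((ContinuousLinearMap.apply ℂ (Lp ℂ p μ) (toComplexLp u)).analyticAt _).comp
      (hF.analyticAt (sector_mem_nhds hθ ht)))).restrictScalars
  have h2 : AnalyticAt ℝ (fun s : ℝ => F (s : ℂ) (toComplexLp u)) t :=
    h1.comp (f := fun s : ℝ => (s : ℂ)) (Complex.ofRealCLM.analyticAt t)
  have h3 := (((RCLike.map ℂ 𝕜).compLpL p μ).analyticAt _).comp h2
  refine h3.congr ?_
  filter_upwards [Ioi_mem_nhds ht] with s hs
  simp only [Function.comp_apply]
  rw [hFS s hs u]
  exact map_complex_toComplexLp _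

end Analytic

/-! ### Families of positive functionals with `φ (t + s) = φ t ∘ S s` -/

section Entrance

variable {α : Type*} [MeasurableSpace α] {μ : Measure α} {p : ℝ≥0∞} [Fact (1 ≤ p)]
  {𝕜 : Type*} [RCLike 𝕜] {S : ℝ → Lp 𝕜 p μ →L[𝕜] Lp 𝕜 p μ} {φ : ℝ → Lp 𝕜 p μ →L[𝕜] 𝕜}

/-- Near `t`, `φ s u = φ (t / 2) (S (s - t / 2) u)`: a fixed functional applied to an analytic
orbit. -/
lemma IsHolomorphic.analyticOnNhd_functional (hS : IsHolomorphic S)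
    (hφ : ∀ t s, 0 < t → 0 < s → φ (t + s) = (φ t).comp (S s)) (u : Lp 𝕜 p μ) :
    AnalyticOnNhd ℝ (fun t => φ t u) (Ioi 0) := by
  intro t ht
  have ht2 : 0 < t / 2 := half_pos ht
  have h1 : AnalyticAt ℝ (fun s : ℝ => S (s - t / 2) u) t :=
    AnalyticAt.comp (g := fun s => S s u) (f := fun s : ℝ => s - t / 2)
      (hS.analyticOnNhd u _ (by simpa using ht2)) (analyticAt_id.sub analyticAt_const)
  refine ((((φ (t / 2)).restrictScalars ℝ).analyticAt _).comp h1).congr ?_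
  filter_upwards [Ioi_mem_nhds (half_lt_self ht)] with s hs
  have := hφ (t / 2) (s - t / 2) ht2 (sub_pos.2 hs)
  rw [add_sub_cancel] at this
  rw [this]
  rfl

/-- Near `0` a nonnegative `u` is approximated by nonnegative elements lying below
`S_{t_k} u` for all large `k`. -/
lemma IsC0Semigroup.exists_approx (hS : IsC0Semigroup S) (hpos : IsPositive S) {u : Lp 𝕜 p μ}
    (hu : 0 ≤ u) {r : ℝ} (hr : 0 < r) :
    ∃ (τ : ℕ → ℝ) (v : ℕ → Lp 𝕜 p μ), (∀ n, 0 < τ n ∧ τ n < r) ∧ Tendsto τ atTop (𝓝 0) ∧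
      Tendsto v atTop (𝓝 u) ∧ (∀ n, 0 ≤ v n) ∧ ∀ n k, n ≤ k → v n ≤ S (τ k) u := by
  have hex : ∀ k : ℕ, ∃ t : ℝ, 0 < t ∧ t < r ∧ t < 1 / ((k : ℝ) + 1) ∧
      ‖u - S t u‖ < (1 / 2 : ℝ) ^ k := by
    intro k
    have h1 : ∀ᶠ t in 𝓝[>] (0 : ℝ), ‖u - S t u‖ < (1 / 2 : ℝ) ^ k := by
      have : Tendsto (fun t => ‖u - S t u‖) (𝓝[>] 0) (𝓝 0) := by
        simpa using ((tendsto_const_nhds (x := u)).sub (hS.tendsto u)).norm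
      exact this.eventually (gt_mem_nhds (by positivity))
    have h2 : ∀ᶠ t in 𝓝[>] (0 : ℝ), t ∈ Ioo 0 r := Ioo_mem_nhdsGT hr
    have h3 : ∀ᶠ t in 𝓝[>] (0 : ℝ), t ∈ Ioo 0 (1 / ((k : ℝ) + 1)) :=
      Ioo_mem_nhdsGT Nat.one_div_pos_of_nat
    obtain ⟨t, h1, h2, h3⟩ := (h1.and (h2.and h3)).exists
    exact ⟨t, h2.1, h2.2, h3.2, h1⟩
  choose τ hτ0 hτr hτ hτS using hex
  let h : ℕ → Lp 𝕜 p μ := fun k => lpAbs (u - S (τ k) u)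
  have hsum : Summable h :=
    Summable.of_norm_bounded summable_geometric_two fun k => by
      rw [norm_lpAbs]
      exact (hτS k).le
  -- The tail dominates `|u - S (τ k) u|` for all `k ≥ n` at once, hence `g n ≤ S (τ k) u`; the
  -- geometric rate makes it tend to `0`.
  let g : ℕ → Lp 𝕜 p μ := fun n => u - ∑' k, h (k + n)
  have hg : Tendsto g atTop (𝓝 u) := by
    simpa [g] using (tendsto_const_nhds (x := u)).sub (tendsto_sum_nat_add h)
  have hgS : ∀ n k, n ≤ k → g n ≤ S (τ k) u := by
    intro n k hnk
    have h1 : h k ≤ ∑' j, h (j + n) := by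
      have := ((summable_nat_add_iff n).2 hsum).le_tsum (k - n) fun j _ => lpAbs_nonneg _
      rwa [Nat.sub_add_cancel hnk] at this
    have h2 : u - S (τ k) u ≤ h k :=
      le_lpAbs_of_le hu (sub_le_self _ (hpos _ (hτ0 k) u hu))
    exact sub_le_comm.1 (h2.trans h1)
  -- `g n` may be negative; its positive part still lies below `S (τ k) u ≥ 0`.
  refine ⟨τ, fun n => (2⁻¹ : 𝕜) • (g n + lpAbs (g n)), fun n => ⟨hτ0 n, hτr n⟩, ?_, ?_, ?_, ?_⟩
  · exact squeeze_zero (fun n => (hτ0 n).le) (fun n => (hτ n).le)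
      tendsto_one_div_add_atTop_nhds_zero_nat
  · have := (hg.add ((continuous_lpAbs.tendsto u).comp hg)).const_smul (2⁻¹ : 𝕜)
    rwa [lpAbs_of_nonneg hu, ← two_smul 𝕜 u, inv_smul_smul₀ two_ne_zero] at this
  · exact fun n => (half_smul_add_lpAbs_mem_Icc (hpos _ (hτ0 n) u hu) (hgS n n le_rfl)).1
  · exact fun n k hnk => (half_smul_add_lpAbs_mem_Icc (hpos _ (hτ0 k) u hu) (hgS n k hnk)).2

lemma functional_eq_zero_of_eq_zero (hS : IsC0Semigroup S) (hpos : IsPositive S)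
    (hhol : IsHolomorphic S) (hφ : ∀ t s, 0 < t → 0 < s → φ (t + s) = (φ t).comp (S s))
    (hφpos : ∀ t, 0 < t → ∀ u, 0 ≤ u → 0 ≤ φ t u) {u : Lp 𝕜 p μ} (hu : 0 ≤ u) {t : ℝ}
    (ht : 0 < t) (h0 : φ t u = 0) {s : ℝ} (hs : 0 < s) : φ s u = 0 := by
  obtain ⟨τ, v, hτ, hτ0, hv, hv0, hvS⟩ := hS.exists_approx hpos hu ht
  have hvn : ∀ n, φ s (v n) = 0 := by
    intro n
    refine (hhol.analyticOnNhd_functional hφ (v n)).eqOn_zero_of_preconnected_of_frequently_eq_zero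
      isPreconnected_Ioi ht ?_ hs
    have hlim : Tendsto (fun k => t - τ k) atTop (𝓝[≠] t) := by
      refine tendsto_nhdsWithin_iff.2 ⟨by simpa using tendsto_const_nhds.sub hτ0, ?_⟩
      exact Eventually.of_forall fun k => by simpa using (hτ k).1.ne'
    refine hlim.frequently (Eventually.frequently ?_)
    filter_upwards [eventually_ge_atTop n] with k hk
    have hpos' : 0 < t - τ k := sub_pos.2 (hτ k).2
    refine le_antisymm ?_ (hφpos _ hpos' _ (hv0 n))
    have h := map_le_map (T := (φ (t - τ k)).toLinearMap) (hφpos _ hpos') (hvS n k hk)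
    refine h.trans_eq ?_
    have h2 := hφ (t - τ k) (τ k) hpos' (hτ k).1
    rw [sub_add_cancel] at h2
    rw [← h0, h2]
    rfl
  refine tendsto_nhds_unique (((φ s).continuous.tendsto u).comp hv) ?_
  simp [Function.comp_def, hvn]

lemma functional_eq_zero_of_exists (hS : IsC0Semigroup S) (hpos : IsPositive S)
    (hirr : IsIrreducible S) (hhol : IsHolomorphic S)
    (hφ : ∀ t s, 0 < t → 0 < s → φ (t + s) = (φ t).comp (S s))
    (hφpos : ∀ t, 0 < t → ∀ u, 0 ≤ u → 0 ≤ φ t u) {u : Lp 𝕜 p μ} (hu : 0 ≤ u) (hu0 : u ≠ 0) {t : ℝ}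
    (ht : 0 < t) (h0 : φ t u = 0) {s : ℝ} (hs : 0 < s) : φ s = 0 := by
  have hmono : ∀ r, 0 < r → ∀ v w : Lp 𝕜 p μ, v ≤ w → φ r v ≤ φ r w := fun r hr v w h =>
    map_le_map (T := (φ r).toLinearMap) (hφpos r hr) h
  -- Requiring vanishing for every `r`, not just one, makes `J` invariant: `φ r ∘ S t = φ (r + t)`.
  let J : Submodule 𝕜 (Lp 𝕜 p μ) :=
    { carrier := {v | ∀ r, 0 < r → φ r (lpAbs v) = 0}
      add_mem' := fun {v w} hv hw r hr => by
        refine le_antisymm ?_ (hφpos r hr _ (lpAbs_nonneg _))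
        refine (hmono r hr _ _ (lpAbs_add_le v w)).trans_eq ?_
        rw [map_add, hv r hr, hw r hr, add_zero]
      zero_mem' := fun r hr => by rw [lpAbs_of_nonneg le_rfl, map_zero]
      smul_mem' := fun c v hv r hr => by rw [lpAbs_smul, map_smul, hv r hr, smul_zero] }
  have hJ : ∀ v, v ∈ J ↔ ∀ r, 0 < r → φ r (lpAbs v) = 0 := fun v => Iff.rfl
  have hideal : IsOrderIdeal J :=
    { abs_mem := fun v hv r hr => by rw [lpAbs_of_nonneg (lpAbs_nonneg v)]; exact hv r hr
      mem_of_le := fun v hv w hw hwv r hr => by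
        refine le_antisymm ?_ (hφpos r hr _ (lpAbs_nonneg _))
        refine (hmono r hr _ _ ?_).trans_eq (hv r hr)
        rwa [lpAbs_of_nonneg hw, lpAbs_of_nonneg (hw.trans hwv)] }
  have hclosed : IsClosed (J : Set (Lp 𝕜 p μ)) := by
    have : (J : Set (Lp 𝕜 p μ)) = ⋂ r ∈ Ioi (0 : ℝ), {v | φ r (lpAbs v) = 0} := by
      ext v
      simp [hJ]
    rw [this]
    exact isClosed_biInter fun r _ =>
      isClosed_eq ((φ r).continuous.comp continuous_lpAbs) continuous_const
  have hinv : ∀ t : ℝ, 0 < t → ∀ v ∈ J, S t v ∈ J := by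
    intro t ht v hv r hr
    refine le_antisymm ?_ (hφpos r hr _ (lpAbs_nonneg _))
    refine (hmono r hr _ _ (lpAbs_map_le (hpos t ht) v)).trans_eq ?_
    have : φ r (S t (lpAbs v)) = 0 := by
      rw [← ContinuousLinearMap.comp_apply, ← hφ r t hr ht]
      exact hv _ (add_pos hr ht)
    rw [map_add, this, add_zero]
  rcases hirr J hideal hclosed hinv with h | h
  · refine absurd ((Submodule.mem_bot 𝕜).1 (h ▸ (hJ u).2 fun r hr => ?_)) hu0
    rw [lpAbs_of_nonneg hu]
    exact functional_eq_zero_of_eq_zero hS hpos hhol hφ hφpos hu ht h0 hr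
  · ext v
    have hv : v ∈ J := h ▸ Submodule.mem_top
    exact map_eq_zero_of_map_lpAbs_eq_zero (hφpos s hs) (hv s hs)

end Entrance

end PosSemigroup

/-! ### Strict positivity at `x` -/

theorem theorem3p1 {𝕜 : Type*} [RCLike 𝕜] {d : ℕ} {p : ℝ≥0∞} [Fact (1 ≤ p)] (hp : p ≠ ∞)
    (Ω : Set (EuclideanSpace ℝ (Fin d))) (hΩ : IsOpen Ω) (hΩne : Ω.Nonempty)
    (S : ℝ → Lp 𝕜 p (volume.restrict Ω) →L[𝕜] Lp 𝕜 p (volume.restrict Ω))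
    (hS : PosSemigroup.IsC0Semigroup S) (hpos : PosSemigroup.IsPositive S)
    (hirr : PosSemigroup.IsIrreducible S) (hhol : PosSemigroup.IsHolomorphic S)
    (X : Set (EuclideanSpace ℝ (Fin d))) (hΩX : Ω ⊆ X) (hXΩ : X ⊆ closure Ω)
    (x : EuclideanSpace ℝ (Fin d)) (hx : x ∈ X)
    (hmap : ∀ t : ℝ, 0 < t → ∀ u : Lp 𝕜 p (volume.restrict Ω),
      ∃ g, PosSemigroup.IsContinuousRep X (S t u) g)
    (hne : ∃ t : ℝ, 0 < t ∧ ∃ w : Lp 𝕜 p (volume.restrict Ω), ∃ g,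
      PosSemigroup.IsContinuousRep X (S t w) g ∧ g x ≠ 0) :
    ∀ t : ℝ, 0 < t → ∀ u : Lp 𝕜 p (volume.restrict Ω), 0 ≤ u → u ≠ 0 →
      ∀ g, PosSemigroup.IsContinuousRep X (S t u) g → 0 < g x := by
  have hex : ∀ t : ℝ, ∃ φ : Lp 𝕜 p (volume.restrict Ω) →L[𝕜] 𝕜, 0 < t →
      ∀ u g, PosSemigroup.IsContinuousRep X (S t u) g → φ u = g x := by
    intro t
    by_cases ht : 0 < t
    · obtain ⟨φ, hφ⟩ := PosSemigroup.exists_clm_eval hΩ hΩX hXΩ hx (S t) (hmap t ht)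
      exact ⟨φ, fun _ => hφ⟩
    · exact ⟨0, fun h => absurd h ht⟩
  choose φ hφ using hex
  have hφS : ∀ t s, 0 < t → 0 < s → φ (t + s) = (φ t).comp (S s) := by
    intro t s ht hs
    ext u
    obtain ⟨g, hg⟩ := hmap t ht (S s u)
    rw [ContinuousLinearMap.comp_apply, hφ t ht _ g hg]
    refine hφ (t + s) (add_pos ht hs) u g ?_
    rwa [hS.add t s ht hs, ContinuousLinearMap.comp_apply]
  have hφpos : ∀ t, 0 < t → ∀ u, 0 ≤ u → 0 ≤ φ t u := by
    intro t ht u hu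
    obtain ⟨g, hg⟩ := hmap t ht u
    rw [hφ t ht u g hg]
    exact hg.nonneg hΩ hΩX hXΩ hx (hpos t ht u hu)
  intro t ht u hu hu0 g hg
  refine lt_of_le_of_ne (hg.nonneg hΩ hΩX hXΩ hx (hpos t ht u hu)) fun h0 => ?_
  obtain ⟨s, hs, w, k, hk, hk0⟩ := hne
  refine hk0 ?_
  rw [← hφ s hs w k hk, PosSemigroup.functional_eq_zero_of_exists hS hpos hirr hhol hφS hφpos hu hu0
    ht ((hφ t ht u g hg).trans h0.symm) hs]
  rfl
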